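/- Draw the square grid rotated by 45 degrees. A staircase polyomino with $m$ entries ($m \ge 2$) is the region enclosed by two lattice paths (top and bottom) of $m$ steps each, consisting of up-steps (north-east) and down-steps (south-east), which run from the leftmost corner to the rightmost corner and meet only at these two corners. The $m$ steps of the top path are the faucets and the $m$ steps of the bottom path are the customers, both numbered from left to right. The cells of the polyomino are called its intersections: each of them is the intersection of an uphill street (a row of cells in the north-east direction) with a downhill avenue (a row of cells in the south-east direction). For a set $S$ of intersections, place an elbow at each intersection in $S$ and a crossing at each other intersection. Water comes down from the faucets along the pipes. At a crossing, the water entering through the north-west (resp. north-east) side of the cell leaves through its south-east (resp. south-west) side; at an elbow, it leaves through the south-west (resp. south-east) side. Let $\sigma_S$ be the permutation of $[m]$ such that the water of the $i$-th faucet reaches the $\sigma_S(i)$-th customer, and let $\tau = \sigma_\varnothing$ (only crossings). A diamond is the set of cells in the intersection of an interval of consecutive streets with an interval of consecutive avenues; it fits if all these cells belong to the polyomino, and its left, right, bottom and top vertices are its four extreme cells. Denote by $\ell(\sigma)$ the number of inversions of $\sigma$. **Theorem.** Consider any staircase polyomino with $m$ entries, and let (a) $\mathcal A$ be the set of all sets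 $S$ of intersections such that, whenever $S$ contains the left and right vertices of a fitting diamond, $S$ also contains its bottom vertex, (b) $\mathcal B$ be the set of all sets $S$ of intersections such that, whenever $S$ contains the left and right vertices of a fitting diamond, $S$ also contains its top vertex, (c) $\mathcal C$ be the set of all permutations $\sigma$ of $[m]$ with $\sigma \le \tau$ in the strong Bruhat order (that is, some reduced expression of $\sigma$ is a subword of some reduced expression of $\tau$). Then $S \mapsto \sigma_S$ restricts to a bijection from $\mathcal A$ to $\mathcal C$ and to a bijection from $\mathcal B$ to $\mathcal C$, and both are size preserving: $|S| = \ell(\tau) - \ell(\sigma_S)$ for all $S$ in $\mathcal A$ or in $\mathcal B$. In particular there is a bijection from $\mathcal A$ to $\mathcal B$ which preserves both the cardinality $|S|$ and the permutation $\sigma_S$. -/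

import Mathlib

/-- The number of up-steps among the first `k` steps of a path with `m` steps `w`
(`true` is an up-step, going north-east; `false` is a down-step, going south-east). -/
def upCount {m : ℕ} (w : Fin m → Bool) (k : ℕ) : ℕ :=
  (Finset.univ.filter fun i : Fin m => (i : ℕ) < k ∧ w i = true).card

/-- A staircase polyomino with `m` entries, drawn in the square grid rotated by 45 degrees.
It is bounded by two paths with `m` up- and down-steps each, read from left to right, which go from
the leftmost corner to the rightmost corner and meet only at these two corners, the first path
running above the second. After `k` steps a path with `u` up-steps is at abscissa `k` and height
`2 * u - k`, so that "above" means that more up-steps were used.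
The faucets `0, …, m - 1` are the steps of the top path, the customers `0, …, m - 1` are the steps
of the bottom path, both numbered from left to right. -/
structure StaircasePolyomino (m : ℕ) where
  /-- The steps of the top path. -/
  top : Fin m → Bool
  /-- The steps of the bottom path. -/
  bot : Fin m → Bool
  two_le : 2 ≤ m
  same_end : upCount bot m = upCount top m
  bot_lt_top : ∀ k, 0 < k → k < m → upCount bot k < upCount top k

/-- The simple transposition exchanging `k` and `k + 1` in `{0, …, m - 1}`
(for `k + 1 ≥ m`, which never matters, it is the identity). -/
def adjSwap (m k : ℕ) : Equiv.Perm (Fin m) :=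
  if h : k + 1 < m then Equiv.swap ⟨k, Nat.lt_of_succ_lt h⟩ ⟨k + 1, h⟩ else 1

/-- The product of a word on the simple transpositions. -/
def wordProd (m : ℕ) (w : List ℕ) : Equiv.Perm (Fin m) :=
  (w.map (adjSwap m)).prod

/-- A word on the simple transpositions is reduced if no shorter word has the same product. -/
def IsReducedWord (m : ℕ) (w : List ℕ) : Prop :=
  ∀ w' : List ℕ, wordProd m w' = wordProd m w → w.length ≤ w'.length

/-- The strong Bruhat order on permutations of `{0, …, m - 1}`: `σ ≤ τ` if some reduced expression
of `σ` is a (not necessarily contiguous) subword of some reduced expression of `τ`. -/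
def BruhatLE {m : ℕ} (σ τ : Equiv.Perm (Fin m)) : Prop :=
  ∃ u v : List ℕ, IsReducedWord m u ∧ IsReducedWord m v ∧
    wordProd m u = σ ∧ wordProd m v = τ ∧ u.Sublist v

/-- The number of inversions (that is, the length) of a permutation. -/
def invCount {m : ℕ} (σ : Equiv.Perm (Fin m)) : ℕ :=
  (Finset.univ.filter fun p : Fin m × Fin m => p.1 < p.2 ∧ σ p.2 < σ p.1).card

namespace StaircasePolyomino

variable {m : ℕ} (P : StaircasePolyomino m)

/-- The cell `(a, b)` of the grid, the intersection of the `a`-th uphill street with the `b`-th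
downhill avenue (numbered from `0`), has its left, top, bottom and right corners at the points
reached from the leftmost corner of the polyomino by `(b, a)`, `(b + 1, a)`, `(b, a + 1)` and
`(b + 1, a + 1)` (up-steps, down-steps). It lies in the polyomino if its top corner is not above
the top path and its bottom corner is not below the bottom path, at abscissa `a + b + 1`. -/
def HasCell (c : ℕ × ℕ) : Prop :=
  upCount P.bot (c.1 + c.2 + 1) ≤ c.2 ∧ c.2 < upCount P.top (c.1 + c.2 + 1)

instance (c : ℕ × ℕ) : Decidable (P.HasCell c) := by
  unfold HasCell; infer_instance

/-- The list of all cells `(a, b)` of the polyomino, street by street (`a` increasing) and downwards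
in each street (`b` decreasing). A cell comes after the cells `(a, b + 1)` and `(a - 1, b)` from
which it receives its water. -/
def cellList : List (ℕ × ℕ) :=
  ((List.range m).flatMap fun a => (List.range m).reverse.map fun b => (a, b)).filter
    fun c => P.HasCell c

/-- The intersections (cells) of the polyomino. -/
def cells : Finset (ℕ × ℕ) := P.cellList.toFinset

/-- The list `cellList` misses no cell of the polyomino. -/
theorem mem_cells (c : ℕ × ℕ) : c ∈ P.cells ↔ P.HasCell c := by
  have h1 : ∀ k, m ≤ k → ∀ w : Fin m → Bool, upCount w k = upCount w m := by
    intro k hk w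
    unfold upCount
    congr 1
    ext i
    have := i.isLt
    simp only [Finset.mem_filter, Finset.mem_univ, true_and]
    constructor <;> rintro ⟨_, h⟩ <;> exact ⟨by omega, h⟩
  simp only [cells, cellList, List.mem_toFinset, List.mem_filter, List.mem_flatMap, List.mem_map, List.mem_reverse, List.mem_range, decide_eq_true_eq]
  refine ⟨fun h => h.2, fun h => ⟨⟨c.1, ?_, c.2, ?_, rfl⟩, h⟩⟩ <;>
  · by_contra hc
    have h2 := h1 (c.1 + c.2 + 1) (by omega)
    have h3 := P.same_end
    obtain ⟨h4, h5⟩ := h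
    rw [h2] at h4 h5
    omega

/-- The water flows from the faucets down to the customers, through a system of pipes that has an
elbow at each intersection in `S` and a crossing at each other intersection. Through the cell
`(a, b)` run two pipes, in the vertical strips `a + b` and `a + b + 1` (the strip `k` lies between
the abscissas `k` and `k + 1`, and holds the faucet `k` and the customer `k`). They exchange
strips at a crossing, and each of them stays in its strip at an elbow. So the strip of a pipe
is moved by the transpositions of the crossings, in the order in which the water passes them, and
`P.flow S i` is the customer that receives the water of the faucet `i`. -/
def flow (S : Finset (ℕ × ℕ)) : Equiv.Perm (Fin m) :=
  (P.cellList.filter fun c => c ∉ S).foldl (fun π c => adjSwap m (c.1 + c.2) * π) 1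

/-- The permutation of the grid water system, with crossings only. -/
def gridPerm : Equiv.Perm (Fin m) := P.flow ∅

/-- The diamond between the streets `a ≤ a'` and the avenues `b ≤ b'` fits in the polyomino. Its
left, right, bottom and top vertices are `(a, b)`, `(a', b')`, `(a', b)` and `(a, b')`. -/
def DiamondFits (a a' b b' : ℕ) : Prop :=
  a ≤ a' ∧ b ≤ b' ∧ Finset.Icc a a' ×ˢ Finset.Icc b b' ⊆ P.cells

/-- The sets of intersections that contain the bottom vertex of each fitting diamond whose left and
right vertices they contain. -/
def bottomClosed : Set (Finset (ℕ × ℕ)) :=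
  {S | S ⊆ P.cells ∧ ∀ a a' b b', P.DiamondFits a a' b b' →
    (a, b) ∈ S → (a', b') ∈ S → (a', b) ∈ S}

/-- The sets of intersections that contain the top vertex of each fitting diamond whose left and
right vertices they contain. -/
def topClosed : Set (Finset (ℕ × ℕ)) :=
  {S | S ⊆ P.cells ∧ ∀ a a' b b', P.DiamondFits a a' b b' →
    (a, b) ∈ S → (a', b') ∈ S → (a, b') ∈ S}

end StaircasePolyomino

/-!
The permutation of the grid water system is the product of one simple transposition for each cell,
and `σ_S` is the product of the subword of the crossings. Call the subword *positive*
(`IsPositive`) if at every cell, elbow or crossing, the two pipes that meet have not crossed before.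

For every reduced word, the positive subwords parametrize the lower Bruhat interval of its product
(`bijOn_listFlow_isPositive`): a positive subword is reduced, and whether it uses the last letter
can be read off from its product, since this is the case if and only if the letter is a descent of
the product. That each element of the interval arises is the lifting property of the Bruhat order.
It is proved here for the comparison of rank functions (`RankLE.adjSwap_mul`,
`RankLE.of_adjSwap_mul`), which does not depend on a reduced word and is implied by the Bruhat order
(`BruhatLE.rankLE`).

It remains to see that the subword is positive if and only if `S` is closed under top vertices of
diamonds. If two pipes cross at a cell and meet again below it, then in between the left one has
turned at an elbow on the street of the crossing, and the right one at an elbow on its avenue.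
These elbows are the left and the right vertex of a diamond with the crossing as its top vertex, and
the diamond fits since its bottom vertex lies between the crossing and the second meeting
(`IsTopClosed.isPositive`). Conversely, take a smallest diamond with elbows at the left and the
right vertex and a crossing at the top vertex. By minimality the pipes from this crossing follow the
boundary of the diamond, and they meet again at its bottom vertex (`IsPositive.isTopClosed`).
For `S = ∅` this shows that the word of all cells is reduced, and then the number of elbows is the
difference of the lengths.

All this is done for an arbitrary list of cells that are removed one after the other from below a
lattice path (`Peel`). The reflection in a horizontal line is such a list again, and it inverts the
flow (`Peel.reflect`, `listFlow_reflectList`). This gives the statement on bottom vertices.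
-/

/-! ### Adjacent transpositions, ascents and inversions -/

theorem adjSwap_val {m k : ℕ} (hk : k + 1 < m) (x : Fin m) :
    (adjSwap m k x : ℕ) = if (x : ℕ) = k then k + 1 else if (x : ℕ) = k + 1 then k else x := by
  unfold adjSwap
  rw [dif_pos hk, Equiv.swap_apply_def]
  simp only [Fin.ext_iff]
  split_ifs <;> rfl

theorem adjSwap_mul_self (m k : ℕ) : adjSwap m k * adjSwap m k = 1 := by
  unfold adjSwap
  split_ifs <;> simp

theorem adjSwap_inv (m k : ℕ) : (adjSwap m k)⁻¹ = adjSwap m k :=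
  inv_eq_of_mul_eq_one_left (adjSwap_mul_self m k)

theorem adjSwap_mul_cancel {m : ℕ} (k : ℕ) (σ : Equiv.Perm (Fin m)) :
    adjSwap m k * (adjSwap m k * σ) = σ := by
  rw [← mul_assoc, adjSwap_mul_self, one_mul]

/-- The values `k` and `k + 1` occur in this order in `σ`, so that multiplying `σ` by the `k`-th
simple transposition on the left increases the length. -/
def Ascent {m : ℕ} (k : ℕ) (σ : Equiv.Perm (Fin m)) : Prop :=
  ∀ i j : Fin m, (σ i : ℕ) = k → (σ j : ℕ) = k + 1 → i < j

theorem exists_val_eq {m : ℕ} (σ : Equiv.Perm (Fin m)) {k : ℕ} (hk : k < m) :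
    ∃ i, (σ i : ℕ) = k :=
  ⟨σ.symm ⟨k, hk⟩, by simp⟩

theorem eq_of_val_eq {m : ℕ} (σ : Equiv.Perm (Fin m)) {i j : Fin m} (h : (σ i : ℕ) = σ j) :
    i = j :=
  σ.injective (Fin.ext h)

theorem Ascent.not_mul {m k : ℕ} {σ : Equiv.Perm (Fin m)} (hk : k + 1 < m) (h : Ascent k σ) :
    ¬ Ascent k (adjSwap m k * σ) := by
  intro h'
  obtain ⟨i, hi⟩ := exists_val_eq σ (k := k) (by omega)
  obtain ⟨j, hj⟩ := exists_val_eq σ hk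
  have h1 := h i j hi hj
  have h2 := h' j i (by simp [adjSwap_val hk, hj]) (by simp [adjSwap_val hk, hi])
  omega

theorem Ascent.mul_of_not {m k : ℕ} {σ : Equiv.Perm (Fin m)} (hk : k + 1 < m)
    (h : ¬ Ascent k σ) : Ascent k (adjSwap m k * σ) := by
  intro i j hi hj
  simp only [Equiv.Perm.mul_apply, adjSwap_val hk] at hi hj
  by_contra hij
  refine h fun i' j' hi' hj' => ?_
  have h1 : j = i' := eq_of_val_eq σ (by split_ifs at hj <;> omega)
  have h2 : i = j' := eq_of_val_eq σ (by split_ifs at hi <;> omega)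
  have h3 : (i' : ℕ) ≠ j' := fun h3 => by
    rw [Fin.ext h3] at hi'
    omega
  subst h1 h2
  omega

theorem invCount_adjSwap_mul {m k : ℕ} {σ : Equiv.Perm (Fin m)} (hk : k + 1 < m)
    (h : Ascent k σ) : invCount (adjSwap m k * σ) = invCount σ + 1 := by
  obtain ⟨i, hi⟩ := exists_val_eq σ (k := k) (by omega)
  obtain ⟨j, hj⟩ := exists_val_eq σ hk
  have hij := h i j hi hj
  unfold invCount
  rw [← Finset.card_insert_of_notMem (a := (i, j)) (by simp [hi, hj, Fin.le_def])]
  congr 1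
  ext ⟨x, y⟩
  simp only [Finset.mem_filter, Finset.mem_univ, true_and, Finset.mem_insert, Prod.mk.injEq,
    Equiv.Perm.mul_apply, Fin.lt_def, adjSwap_val hk]
  have hx1 : (σ x : ℕ) = k ↔ x = i :=
    ⟨fun e => eq_of_val_eq σ (by omega), fun e => by rw [e, hi]⟩
  have hx2 : (σ x : ℕ) = k + 1 ↔ x = j :=
    ⟨fun e => eq_of_val_eq σ (by omega), fun e => by rw [e, hj]⟩
  have hy1 : (σ y : ℕ) = k ↔ y = i :=
    ⟨fun e => eq_of_val_eq σ (by omega), fun e => by rw [e, hi]⟩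
  have hy2 : (σ y : ℕ) = k + 1 ↔ y = j :=
    ⟨fun e => eq_of_val_eq σ (by omega), fun e => by rw [e, hj]⟩
  rw [← hx1, ← hy2]
  have hx3 : (σ x : ℕ) = k → (x : ℕ) = i := fun e => by rw [hx1.1 e]
  have hx4 : (σ x : ℕ) = k + 1 → (x : ℕ) = j := fun e => by rw [hx2.1 e]
  have hy3 : (σ y : ℕ) = k → (y : ℕ) = i := fun e => by rw [hy1.1 e]
  have hy4 : (σ y : ℕ) = k + 1 → (y : ℕ) = j := fun e => by rw [hy2.1 e]
  rw [Fin.lt_def] at hij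
  split_ifs <;> omega

theorem invCount_one (m : ℕ) : invCount (1 : Equiv.Perm (Fin m)) = 0 := by
  unfold invCount
  rw [Finset.card_eq_zero, Finset.filter_eq_empty_iff]
  rintro ⟨x, y⟩ - ⟨h1, h2⟩
  exact lt_asymm h1 h2

theorem invCount_adjSwap_mul_le {m : ℕ} (k : ℕ) (σ : Equiv.Perm (Fin m)) :
    invCount (adjSwap m k * σ) ≤ invCount σ + 1 := by
  by_cases hk : k + 1 < m
  · by_cases h : Ascent k σ
    · exact (invCount_adjSwap_mul hk h).le
    · have := invCount_adjSwap_mul hk (Ascent.mul_of_not hk h)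
      rw [adjSwap_mul_cancel] at this
      omega
  · simp [adjSwap, hk]

theorem wordProd_cons (m k : ℕ) (w : List ℕ) :
    wordProd m (k :: w) = adjSwap m k * wordProd m w := by
  simp [wordProd]

theorem invCount_wordProd_le (m : ℕ) (w : List ℕ) : invCount (wordProd m w) ≤ w.length := by
  induction w with
  | nil => simp [wordProd, invCount_one]
  | cons k w ih =>
    rw [wordProd_cons, List.length_cons]
    exact (invCount_adjSwap_mul_le k _).trans (by omega)

/-- A permutation without descents is increasing, hence the identity. -/
theorem eq_one_of_forall_ascent {m : ℕ} {σ : Equiv.Perm (Fin m)}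
    (h : ∀ k, k + 1 < m → Ascent k σ) : σ = 1 := by
  have key : StrictMono (fun x : Fin m => σ.symm x) := by
    obtain _ | n := m
    · exact fun x => x.elim0
    · refine Fin.strictMono_iff_lt_succ.2 fun i => ?_
      exact h i (by omega) _ _ (by simp) (by simp)
  have h2 : Set.range (fun x : Fin m => σ.symm x) = Set.range (id : Fin m → Fin m) := by
    rw [Set.range_id]
    exact σ.symm.surjective.range_eq
  have h3 : (fun x : Fin m => σ.symm x) = id := (StrictMono.range_inj key strictMono_id).1 h2
  ext x
  have := congrFun h3 (σ x)
  simp at this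
  simp [← this]

theorem exists_wordProd_eq {m : ℕ} (σ : Equiv.Perm (Fin m)) :
    ∃ w : List ℕ, wordProd m w = σ ∧ w.length = invCount σ := by
  induction hn : invCount σ using Nat.strong_induction_on generalizing σ with
  | _ n ih =>
    by_cases h : ∀ k, k + 1 < m → Ascent k σ
    · have h1 := eq_one_of_forall_ascent h
      subst h1
      rw [invCount_one] at hn
      exact ⟨[], by simp [wordProd], by simp [hn]⟩
    · push Not at h
      obtain ⟨k, hk, h⟩ := h
      have h1 := invCount_adjSwap_mul hk (Ascent.mul_of_not hk h)
      rw [adjSwap_mul_cancel] at h1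
      obtain ⟨w, hw, hl⟩ := ih _ (by omega) (adjSwap m k * σ) rfl
      refine ⟨k :: w, ?_, ?_⟩
      · rw [wordProd_cons, hw, adjSwap_mul_cancel]
      · rw [List.length_cons, hl]
        omega

theorem isReducedWord_iff {m : ℕ} {w : List ℕ} :
    IsReducedWord m w ↔ w.length = invCount (wordProd m w) := by
  constructor
  · intro h
    obtain ⟨w', hw', hl⟩ := exists_wordProd_eq (wordProd m w)
    have := h w' hw'
    have := invCount_wordProd_le m w
    omega
  · intro h w' hw'
    rw [h, ← hw']
    exact invCount_wordProd_le m w'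

theorem IsReducedWord.of_cons {m k : ℕ} {w : List ℕ} (h : IsReducedWord m (k :: w)) :
    IsReducedWord m w ∧ k + 1 < m ∧ Ascent k (wordProd m w) := by
  rw [isReducedWord_iff, wordProd_cons, List.length_cons] at h
  have h1 := invCount_wordProd_le m w
  have h2 := invCount_adjSwap_mul_le k (wordProd m w)
  have hk : k + 1 < m := by
    by_contra hk
    simp [adjSwap, hk] at h
    omega
  refine ⟨isReducedWord_iff.2 (by omega), hk, ?_⟩
  by_contra h3
  have h4 := invCount_adjSwap_mul hk (Ascent.mul_of_not hk h3)
  rw [adjSwap_mul_cancel] at h4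
  omega

theorem wordProd_reverse (m : ℕ) (w : List ℕ) : wordProd m w.reverse = (wordProd m w)⁻¹ := by
  unfold wordProd
  rw [List.prod_inv_reverse, List.map_map, List.map_reverse]
  congr 3
  funext k
  exact (adjSwap_inv m k).symm

theorem IsReducedWord.reverse {m : ℕ} {w : List ℕ} (h : IsReducedWord m w) :
    IsReducedWord m w.reverse := by
  intro w' hw'
  rw [wordProd_reverse] at hw'
  have := h w'.reverse (by rw [wordProd_reverse, hw', inv_inv])
  simpa using this

theorem BruhatLE.inv {m : ℕ} {σ τ : Equiv.Perm (Fin m)} (h : BruhatLE σ τ) :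
    BruhatLE σ⁻¹ τ⁻¹ := by
  obtain ⟨u, v, hu, hv, rfl, rfl, huv⟩ := h
  exact ⟨u.reverse, v.reverse, hu.reverse, hv.reverse, wordProd_reverse m u, wordProd_reverse m v,
    huv.reverse⟩

theorem bruhatLE_inv_iff {m : ℕ} {σ τ : Equiv.Perm (Fin m)} :
    BruhatLE σ⁻¹ τ⁻¹ ↔ BruhatLE σ τ :=
  ⟨fun h => by simpa using h.inv, fun h => h.inv⟩

theorem invCount_inv {m : ℕ} (σ : Equiv.Perm (Fin m)) : invCount σ⁻¹ = invCount σ := by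
  have key : ∀ ρ : Equiv.Perm (Fin m), invCount ρ⁻¹ ≤ invCount ρ := fun ρ => by
    obtain ⟨w, rfl, hl⟩ := exists_wordProd_eq ρ
    rw [← wordProd_reverse, ← hl, ← List.length_reverse]
    exact invCount_wordProd_le m _
  exact le_antisymm (key σ) (by simpa using key σ⁻¹)

/-! ### The rank criterion for the Bruhat order -/

/-- The number of `i < p` with `q ≤ σ i`. -/
def rankCount {m : ℕ} (σ : Equiv.Perm (Fin m)) (p q : ℕ) : ℕ :=
  (Finset.univ.filter fun i : Fin m => (i : ℕ) < p ∧ q ≤ (σ i : ℕ)).card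

/-- The number (`0` or `1`) of `i < p` with `σ i = q`. -/
def hitCount {m : ℕ} (σ : Equiv.Perm (Fin m)) (p q : ℕ) : ℕ :=
  (Finset.univ.filter fun i : Fin m => (i : ℕ) < p ∧ (σ i : ℕ) = q).card

/-- Comparison of the rank functions. This is equivalent to the Bruhat order, but in contrast to the
definition by reduced words it does not refer to a choice of words. -/
def RankLE {m : ℕ} (σ τ : Equiv.Perm (Fin m)) : Prop :=
  ∀ p q, rankCount σ p q ≤ rankCount τ p q

theorem rankCount_eq_add {m : ℕ} (σ : Equiv.Perm (Fin m)) (p q : ℕ) :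
    rankCount σ p q = rankCount σ p (q + 1) + hitCount σ p q := by
  unfold rankCount hitCount
  rw [← Finset.card_union_of_disjoint]
  · congr 1
    ext i
    simp only [Finset.mem_filter, Finset.mem_univ, true_and, Finset.mem_union]
    omega
  · rw [Finset.disjoint_filter]
    intro i _ h1 h2
    omega

theorem hitCount_le_one {m : ℕ} (σ : Equiv.Perm (Fin m)) (p q : ℕ) : hitCount σ p q ≤ 1 := by
  refine Finset.card_le_one.2 fun i hi j hj => ?_
  simp only [Finset.mem_filter, Finset.mem_univ, true_and] at hi hj
  exact eq_of_val_eq σ (by omega)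

theorem Ascent.hitCount_le {m k : ℕ} {σ : Equiv.Perm (Fin m)} (hk : k + 1 < m) (h : Ascent k σ)
    (p : ℕ) : hitCount σ p (k + 1) ≤ hitCount σ p k := by
  obtain ⟨i, hi⟩ := exists_val_eq σ (k := k) (by omega)
  refine Finset.card_le_card_of_injOn (fun _ => i) (fun j hj => ?_) fun j hj j' hj' _ => ?_
  · simp only [Finset.coe_filter, Finset.mem_univ, true_and, Set.mem_ofPred_eq] at hj ⊢
    have := h i j hi hj.2
    exact ⟨by omega, hi⟩
  · simp only [Finset.coe_filter, Finset.mem_univ, true_and, Set.mem_ofPred_eq] at hj hj'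
    exact eq_of_val_eq σ (by omega)

theorem hitCount_adjSwap_mul {m k : ℕ} (hk : k + 1 < m) (σ : Equiv.Perm (Fin m)) (p : ℕ) :
    hitCount (adjSwap m k * σ) p k = hitCount σ p (k + 1) ∧
      hitCount (adjSwap m k * σ) p (k + 1) = hitCount σ p k := by
  unfold hitCount
  constructor <;> congr 1 <;> ext i <;>
    simp only [Finset.mem_filter, Finset.mem_univ, true_and, Equiv.Perm.mul_apply,
      adjSwap_val hk] <;> split_ifs <;> omega

theorem rankCount_adjSwap_mul {m k : ℕ} (hk : k + 1 < m) (σ : Equiv.Perm (Fin m)) (p : ℕ) {q : ℕ}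
    (hq : q ≠ k + 1) : rankCount (adjSwap m k * σ) p q = rankCount σ p q := by
  unfold rankCount
  congr 1
  ext i
  simp only [Finset.mem_filter, Finset.mem_univ, true_and, Equiv.Perm.mul_apply, adjSwap_val hk]
  split_ifs <;> omega

theorem RankLE.adjSwap_mul_right {m k : ℕ} {σ τ : Equiv.Perm (Fin m)} (hk : k + 1 < m)
    (hτ : Ascent k τ) (h : RankLE σ τ) : RankLE σ (adjSwap m k * τ) := by
  intro p q
  have h1 := h p q
  by_cases hq : q = k + 1
  · subst hq
    have h2 := rankCount_adjSwap_mul hk τ p (q := k) (by omega)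
    have h3 := rankCount_eq_add τ p k
    have h4 := rankCount_eq_add (adjSwap m k * τ) p k
    have h5 := hitCount_adjSwap_mul hk τ p
    have h6 := hτ.hitCount_le hk p
    omega
  · rwa [rankCount_adjSwap_mul hk τ p hq]

/-- Half of the lifting property: passing to the larger of `σ` and `s * σ`, and to the larger of
`τ` and `s * τ`, is monotone. Here and in `RankLE.of_adjSwap_mul` only the rank functions at `k` and
at `k + 2`, which `s` does not change, are compared. -/
theorem RankLE.adjSwap_mul {m k : ℕ} {σ τ : Equiv.Perm (Fin m)} (hk : k + 1 < m)
    (hτ : Ascent k τ) (h : RankLE σ τ) : RankLE (adjSwap m k * σ) (adjSwap m k * τ) := by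
  intro p q
  by_cases hq : q = k + 1
  · subst hq
    have a1 := h p k
    have a2 := h p (k + 2)
    have b1 := rankCount_adjSwap_mul hk τ p (q := k) (by omega)
    have b2 := rankCount_adjSwap_mul hk σ p (q := k) (by omega)
    have c1 := rankCount_eq_add τ p k
    have c2 := rankCount_eq_add τ p (k + 1)
    have c3 := rankCount_eq_add σ p k
    have c4 := rankCount_eq_add σ p (k + 1)
    have c5 := rankCount_eq_add (adjSwap m k * σ) p k
    have c6 := rankCount_eq_add (adjSwap m k * τ) p k
    have d1 := hitCount_adjSwap_mul hk τ p
    have d2 := hitCount_adjSwap_mul hk σ p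
    have e1 := hτ.hitCount_le hk p
    have f1 := hitCount_le_one σ p k
    have f2 := hitCount_le_one σ p (k + 1)
    have f3 := hitCount_le_one τ p k
    have f4 := hitCount_le_one τ p (k + 1)
    simp only [add_assoc, Nat.reduceAdd] at c2 c4
    omega
  · rw [rankCount_adjSwap_mul hk σ p hq, rankCount_adjSwap_mul hk τ p hq]
    exact h p q

/-- The other half of the lifting property: passing to the smaller of `σ` and `s * σ`, and to the
smaller of `τ` and `s * τ`, is monotone. -/
theorem RankLE.of_adjSwap_mul {m k : ℕ} {σ τ : Equiv.Perm (Fin m)} (hk : k + 1 < m)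
    (hσ : Ascent k σ) (h : RankLE σ (adjSwap m k * τ)) : RankLE σ τ := by
  intro p q
  by_cases hq : q = k + 1
  · subst hq
    have a1 := h p k
    have a2 := h p (k + 2)
    have b1 := rankCount_adjSwap_mul hk τ p (q := k) (by omega)
    have b2 := rankCount_adjSwap_mul hk τ p (q := k + 2) (by omega)
    have c1 := rankCount_eq_add τ p k
    have c2 := rankCount_eq_add τ p (k + 1)
    have c3 := rankCount_eq_add σ p k
    have c4 := rankCount_eq_add σ p (k + 1)
    have e1 := hσ.hitCount_le hk p
    have f1 := hitCount_le_one σ p k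
    have f2 := hitCount_le_one σ p (k + 1)
    have f3 := hitCount_le_one τ p k
    have f4 := hitCount_le_one τ p (k + 1)
    simp only [add_assoc, Nat.reduceAdd] at c2 c4
    omega
  · have := h p q
    rwa [rankCount_adjSwap_mul hk τ p hq] at this

theorem RankLE.adjSwap_mul_left {m k : ℕ} {σ τ : Equiv.Perm (Fin m)} (hk : k + 1 < m)
    (hσ : ¬ Ascent k σ) (h : RankLE σ (adjSwap m k * τ)) : RankLE (adjSwap m k * σ) τ := by
  refine RankLE.of_adjSwap_mul hk (Ascent.mul_of_not hk hσ) fun p q => ?_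
  by_cases hq : q = k + 1
  · subst hq
    have h1 := h p (k + 1)
    have b2 := rankCount_adjSwap_mul hk σ p (q := k) (by omega)
    have c3 := rankCount_eq_add σ p k
    have c5 := rankCount_eq_add (adjSwap m k * σ) p k
    have d2 := hitCount_adjSwap_mul hk σ p
    have e1 := (Ascent.mul_of_not hk hσ).hitCount_le hk p
    omega
  · rw [rankCount_adjSwap_mul hk σ p hq]
    exact h p q

theorem RankLE.eq_one {m : ℕ} {σ : Equiv.Perm (Fin m)} (h : RankLE σ 1) : σ = 1 := by
  have key : ∀ (i : Fin m) (p : ℕ), (i : ℕ) < p → (σ i : ℕ) < p := fun i p hi => by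
    have h1 : rankCount (1 : Equiv.Perm (Fin m)) p p = 0 := by
      unfold rankCount
      rw [Finset.card_eq_zero, Finset.filter_eq_empty_iff]
      intro i _
      simp
    have h2 : rankCount σ p p = 0 := by have := h p p; omega
    unfold rankCount at h2
    rw [Finset.card_eq_zero, Finset.filter_eq_empty_iff] at h2
    have := h2 (Finset.mem_univ i)
    omega
  have h3 : ∀ i, (σ i : ℕ) ≤ i := fun i => Nat.lt_succ_iff.1 (key i (i + 1) (Nat.lt_succ_self _))
  -- `σ` permutes the summands of `∑ i, i`, so no term can decrease
  have h4 := (Finset.sum_eq_sum_iff_of_le fun i _ => h3 i).1 (Equiv.sum_comp σ fun i => (i : ℕ))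
  ext i
  exact h4 i (Finset.mem_univ i)

theorem RankLE.of_sublist {m : ℕ} {u v : List ℕ} (hv : IsReducedWord m v) (huv : u.Sublist v) :
    RankLE (wordProd m u) (wordProd m v) := by
  induction huv with
  | slnil => exact fun p q => le_rfl
  | cons k _ ih =>
    obtain ⟨h1, h2, h3⟩ := hv.of_cons
    rw [wordProd_cons]
    exact (ih h1).adjSwap_mul_right h2 h3
  | cons_cons k _ ih =>
    obtain ⟨h1, h2, h3⟩ := hv.of_cons
    rw [wordProd_cons, wordProd_cons]
    exact (ih h1).adjSwap_mul h2 h3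

theorem BruhatLE.rankLE {m : ℕ} {σ τ : Equiv.Perm (Fin m)} (h : BruhatLE σ τ) : RankLE σ τ := by
  obtain ⟨u, v, -, hv, rfl, rfl, huv⟩ := h
  exact RankLE.of_sublist hv huv

/-! ### Water flowing through a list of cells -/

/-- The flow through the cells of a list, in this order, with elbows at the cells in `S`. -/
def listFlow (m : ℕ) (S : Finset (ℕ × ℕ)) (l : List (ℕ × ℕ)) : Equiv.Perm (Fin m) :=
  (l.filter fun c => c ∉ S).foldl (fun π c => adjSwap m (c.1 + c.2) * π) 1

theorem listFlow_append_singleton (m : ℕ) (S : Finset (ℕ × ℕ)) (l : List (ℕ × ℕ)) (c : ℕ × ℕ) :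
    listFlow m S (l ++ [c]) =
      if c ∈ S then listFlow m S l else adjSwap m (c.1 + c.2) * listFlow m S l := by
  unfold listFlow
  by_cases h : c ∈ S <;> simp [h, List.filter_append]

theorem listFlow_congr {m : ℕ} {S T : Finset (ℕ × ℕ)} {l : List (ℕ × ℕ)}
    (h : ∀ c ∈ l, c ∈ S ↔ c ∈ T) : listFlow m S l = listFlow m T l := by
  unfold listFlow
  congr 1
  exact List.filter_congr fun c hc => by simp [h c hc]

/-- The word of the crossings. The last crossing comes first, since it acts last. -/
def crossingWord (S : Finset (ℕ × ℕ)) (l : List (ℕ × ℕ)) : List ℕ :=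
  ((l.filter fun c => c ∉ S).map fun c => c.1 + c.2).reverse

theorem wordProd_crossingWord (m : ℕ) (S : Finset (ℕ × ℕ)) (l : List (ℕ × ℕ)) :
    wordProd m (crossingWord S l) = listFlow m S l := by
  unfold crossingWord listFlow
  rw [List.foldl_eq_foldr_reverse, ← List.map_reverse]
  generalize (l.filter fun c => c ∉ S).reverse = w
  induction w with
  | nil => simp [wordProd]
  | cons c w ih => rw [List.map_cons, wordProd_cons, ih, List.foldr_cons]

theorem crossingWord_sublist (S : Finset (ℕ × ℕ)) (l : List (ℕ × ℕ)) :
    (crossingWord S l).Sublist (crossingWord ∅ l) := by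
  unfold crossingWord
  refine List.reverse_sublist.2 (List.Sublist.map _ ?_)
  simp

/-- At each cell of the list, elbow or crossing, the two pipes that meet there are still in the
order of their faucets. In other words, the crossings form a positive distinguished subexpression
of the word of all cells. -/
def IsPositive (m : ℕ) (S : Finset (ℕ × ℕ)) (l : List (ℕ × ℕ)) : Prop :=
  ∀ l₁ c l₂, l = l₁ ++ c :: l₂ → Ascent (c.1 + c.2) (listFlow m S l₁)

theorem isPositive_append_singleton {m : ℕ} {S : Finset (ℕ × ℕ)} {l : List (ℕ × ℕ)} {c : ℕ × ℕ} :
    IsPositive m S (l ++ [c]) ↔ IsPositive m S l ∧ Ascent (c.1 + c.2) (listFlow m S l) := by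
  constructor
  · intro h
    exact ⟨fun l₁ d l₂ hl => h l₁ d (l₂ ++ [c]) (by simp [hl]), h l c [] rfl⟩
  · rintro ⟨h1, h2⟩ l₁ d l₂ hl
    obtain rfl | ⟨l₃, e, rfl⟩ := l₂.eq_nil_or_concat'
    · obtain ⟨rfl, h⟩ := List.append_inj' hl rfl
      simp only [List.cons.injEq, and_true] at h
      exact h ▸ h2
    · rw [← List.cons_append, ← List.append_assoc] at hl
      exact h1 l₁ d l₃ (List.append_inj' hl rfl).1

theorem IsPositive.congr {m : ℕ} {S T : Finset (ℕ × ℕ)} {l : List (ℕ × ℕ)}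
    (h : ∀ c ∈ l, c ∈ S ↔ c ∈ T) (hS : IsPositive m S l) : IsPositive m T l := by
  intro l₁ c l₂ hl
  rw [← listFlow_congr (S := S) fun d hd => h d (by simp [hl, hd])]
  exact hS l₁ c l₂ hl

/-- In a positive subexpression each crossing increases the length by one. -/
theorem IsPositive.invCount_listFlow {m : ℕ} {S : Finset (ℕ × ℕ)} {l : List (ℕ × ℕ)}
    (hl : ∀ c ∈ l, c.1 + c.2 + 1 < m) (hS : IsPositive m S l) :
    invCount (listFlow m S l) = (l.filter fun c => c ∉ S).length := by
  induction l using List.reverseRecOn with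
  | nil => simp [listFlow, invCount_one]
  | append_singleton l c ih =>
    obtain ⟨h1, h2⟩ := isPositive_append_singleton.1 hS
    have h3 := ih (fun d hd => hl d (by simp [hd])) h1
    rw [listFlow_append_singleton, List.filter_append, List.length_append, ← h3]
    by_cases hc : c ∈ S
    · simp [hc]
    · rw [if_neg hc, invCount_adjSwap_mul (hl c (by simp)) h2]
      simp [hc]

theorem IsPositive.isReducedWord {m : ℕ} {S : Finset (ℕ × ℕ)} {l : List (ℕ × ℕ)}
    (hl : ∀ c ∈ l, c.1 + c.2 + 1 < m) (hS : IsPositive m S l) :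
    IsReducedWord m (crossingWord S l) := by
  rw [isReducedWord_iff, wordProd_crossingWord, hS.invCount_listFlow hl]
  simp [crossingWord]

theorem IsPositive.bruhatLE {m : ℕ} {S : Finset (ℕ × ℕ)} {l : List (ℕ × ℕ)}
    (hl : ∀ c ∈ l, c.1 + c.2 + 1 < m) (h0 : IsPositive m ∅ l) (hS : IsPositive m S l) :
    BruhatLE (listFlow m S l) (listFlow m ∅ l) :=
  ⟨_, _, hS.isReducedWord hl, h0.isReducedWord hl, wordProd_crossingWord m S l,
    wordProd_crossingWord m ∅ l, crossingWord_sublist S l⟩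

/-- A positive subexpression is determined by its product: whether its last letter is used can be
read off from the product. -/
theorem IsPositive.eq_of_listFlow_eq {m : ℕ} {S T : Finset (ℕ × ℕ)} {l : List (ℕ × ℕ)}
    (hl : ∀ c ∈ l, c.1 + c.2 + 1 < m) (hS : IsPositive m S l) (hT : IsPositive m T l)
    (h : listFlow m S l = listFlow m T l) : ∀ c ∈ l, c ∈ S ↔ c ∈ T := by
  induction l using List.reverseRecOn with
  | nil => simp
  | append_singleton l c ih =>
    obtain ⟨h1, h2⟩ := isPositive_append_singleton.1 hS
    obtain ⟨h3, h4⟩ := isPositive_append_singleton.1 hT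
    have hc := hl c (by simp)
    rw [listFlow_append_singleton, listFlow_append_singleton] at h
    have key : (c ∈ S ↔ c ∈ T) ∧ listFlow m S l = listFlow m T l := by
      by_cases hcS : c ∈ S <;> by_cases hcT : c ∈ T <;> simp only [hcS, hcT, if_true, if_false] at h
      · exact ⟨by simp [hcS, hcT], h⟩
      · exact absurd (h ▸ h2) (h4.not_mul hc)
      · exact absurd (h ▸ h4) (h2.not_mul hc)
      · exact ⟨by simp [hcS, hcT], mul_left_cancel h⟩
    intro d hd
    obtain hd | hd := List.mem_append.1 hd
    · exact ih (fun e he => hl e (by simp [he])) h1 h3 key.2 d hd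
    · rw [List.mem_singleton.1 hd]
      exact key.1

theorem exists_isPositive_of_rankLE {m : ℕ} {l : List (ℕ × ℕ)} {σ : Equiv.Perm (Fin m)}
    (hl : ∀ c ∈ l, c.1 + c.2 + 1 < m) (hn : l.Nodup) (h0 : IsPositive m ∅ l)
    (h : RankLE σ (listFlow m ∅ l)) :
    ∃ S ⊆ l.toFinset, IsPositive m S l ∧ listFlow m S l = σ := by
  induction l using List.reverseRecOn generalizing σ with
  | nil =>
    have h1 : listFlow m ∅ [] = 1 := by simp [listFlow]
    rw [h1] at h
    exact ⟨∅, by simp, h0, by rw [h1, h.eq_one]⟩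
  | append_singleton l c ih =>
    obtain ⟨h1, h2⟩ := isPositive_append_singleton.1 h0
    have hc := hl c (by simp)
    have hl' : ∀ e ∈ l, e.1 + e.2 + 1 < m := fun e he => hl e (by simp [he])
    obtain ⟨hn', -, hcl⟩ := List.nodup_append.1 hn
    have hcl : c ∉ l := fun h => hcl c h c (by simp) rfl
    rw [listFlow_append_singleton, if_neg (by simp)] at h
    by_cases hσ : Ascent (c.1 + c.2) σ
    · -- the last cell has to be an elbow
      obtain ⟨S, hS, hp, hf⟩ := ih hl' hn' h1 (h.of_adjSwap_mul hc hσ)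
      have hST : ∀ d ∈ l, d ∈ S ↔ d ∈ insert c S := fun d hd => by
        have : d ≠ c := fun e => hcl (e ▸ hd)
        simp [this]
      refine ⟨insert c S, ?_, isPositive_append_singleton.2 ⟨hp.congr hST, ?_⟩, ?_⟩
      · intro d hd
        obtain rfl | hd := Finset.mem_insert.1 hd
        · simp
        · have := hS hd
          simp_all
      · rwa [← listFlow_congr hST, hf]
      · rw [listFlow_append_singleton, if_pos (by simp), ← listFlow_congr hST, hf]
    · obtain ⟨S, hS, hp, hf⟩ := ih hl' hn' h1 (h.adjSwap_mul_left hc hσ)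
      have hcS : c ∉ S := fun h => hcl (List.mem_toFinset.1 (hS h))
      refine ⟨S, fun d hd => ?_, isPositive_append_singleton.2 ⟨hp, ?_⟩, ?_⟩
      · have := hS hd
        simp_all
      · rw [hf]
        exact Ascent.mul_of_not hc hσ
      · rw [listFlow_append_singleton, if_neg hcS, hf, adjSwap_mul_cancel]

/-- The positive subexpressions of a reduced word parametrize the lower Bruhat interval of its
product. -/
theorem bijOn_listFlow_isPositive {m : ℕ} {l : List (ℕ × ℕ)}
    (hl : ∀ c ∈ l, c.1 + c.2 + 1 < m) (hn : l.Nodup) (h0 : IsPositive m ∅ l) :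
    Set.BijOn (fun S => listFlow m S l) {S | S ⊆ l.toFinset ∧ IsPositive m S l}
      {σ | BruhatLE σ (listFlow m ∅ l)} := by
  refine ⟨fun S hS => IsPositive.bruhatLE hl h0 hS.2, fun S hS T hT h => ?_, fun σ hσ => ?_⟩
  · have := hS.2.eq_of_listFlow_eq hl hT.2 h
    ext c
    by_cases hc : c ∈ l
    · exact this c hc
    · exact iff_of_false (fun h => hc (List.mem_toFinset.1 (hS.1 h)))
        fun h => hc (List.mem_toFinset.1 (hT.1 h))
  · obtain ⟨S, hS, hp, hf⟩ := exists_isPositive_of_rankLE hl hn h0 (BruhatLE.rankLE hσ)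
    exact ⟨S, ⟨hS, hp⟩, hf⟩

theorem IsPositive.card_add_invCount {m : ℕ} {S : Finset (ℕ × ℕ)} {l : List (ℕ × ℕ)}
    (hl : ∀ c ∈ l, c.1 + c.2 + 1 < m) (hn : l.Nodup) (h0 : IsPositive m ∅ l)
    (hS : IsPositive m S l) (hSl : S ⊆ l.toFinset) :
    S.card + invCount (listFlow m S l) = invCount (listFlow m ∅ l) := by
  rw [hS.invCount_listFlow hl, h0.invCount_listFlow hl]
  have h1 : (l.filter fun c => c ∈ S).length = S.card := by
    rw [← List.toFinset_card_of_nodup (hn.filter _), List.toFinset_filter]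
    congr 1
    ext c
    simp only [Finset.mem_filter, List.mem_toFinset, decide_eq_true_eq, and_iff_right_iff_imp]
    exact fun h => List.mem_toFinset.1 (hSl h)
  have h2 := List.length_eq_length_filter_add (l := l) fun c => c ∈ S
  simp only [Finset.notMem_empty, not_false_eq_true, decide_true, List.filter_true]
  rw [← h1, h2]
  simp

/-! ### Removing the cells below a lattice path one after the other -/

/-- The function `h` records the number of up-steps in the initial segments of a lattice path of up-
and down-steps. -/
def IsHeight (h : ℕ → ℕ) : Prop :=
  ∀ n, h n ≤ h (n + 1) ∧ h (n + 1) ≤ h n + 1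

theorem IsHeight.le_of_le {h : ℕ → ℕ} (hh : IsHeight h) {n n' : ℕ} (hn : n ≤ n') :
    h n ≤ h n' ∧ h n' + n ≤ h n + n' := by
  induction n', hn using Nat.le_induction with
  | base => exact ⟨le_rfl, le_rfl⟩
  | succ n' _ ih =>
    have := hh n'
    omega

/-- Removing the cell `c` below the top corner of the path `g` turns an up-step followed by a
down-step into a down-step followed by an up-step; the result is the path `g'`. -/
structure PeelStep (g : ℕ → ℕ) (c : ℕ × ℕ) (g' : ℕ → ℕ) : Prop where
  left : g (c.1 + c.2) = c.2
  mid : g (c.1 + c.2 + 1) = c.2 + 1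
  right : g (c.1 + c.2 + 1 + 1) = c.2 + 1
  new : g' (c.1 + c.2 + 1) = c.2
  other : ∀ n, n ≠ c.1 + c.2 + 1 → g' n = g n

theorem PeelStep.isHeight {g g' : ℕ → ℕ} {c : ℕ × ℕ} (hg : IsHeight g) (hs : PeelStep g c g') :
    IsHeight g' := by
  intro n
  obtain ⟨h1, h2, h3, h4, h5⟩ := hs
  have h6 := hg n
  by_cases hn : n = c.1 + c.2
  · subst hn
    rw [h4, h5 _ (by omega)]
    omega
  · by_cases hn' : n = c.1 + c.2 + 1
    · subst hn'
      rw [h4, h5 _ (by omega)]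
      omega
    · rwa [h5 n hn', h5 (n + 1) (by omega)]

/-- Removing the cells of the list one after the other turns the path `h` into the path `g`. -/
inductive Peel (h : ℕ → ℕ) : List (ℕ × ℕ) → (ℕ → ℕ) → Prop
  | nil : Peel h [] h
  | snoc {l : List (ℕ × ℕ)} {g g' : ℕ → ℕ} {c : ℕ × ℕ} :
    Peel h l g → PeelStep g c g' → Peel h (l ++ [c]) g'

namespace Peel

variable {h g : ℕ → ℕ} {l : List (ℕ × ℕ)}

theorem append {g' : ℕ → ℕ} {l' : List (ℕ × ℕ)} (h₁ : Peel h l g) (h₂ : Peel g l' g') :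
    Peel h (l ++ l') g' := by
  induction h₂ with
  | nil => simpa using h₁
  | snoc _ hs ih =>
    rw [← List.append_assoc]
    exact ih.snoc hs

theorem exists_of_snoc {c : ℕ × ℕ} {g' : ℕ → ℕ} (hp : Peel h (l ++ [c]) g') :
    ∃ g, Peel h l g ∧ PeelStep g c g' := by
  generalize hl : l ++ [c] = L at hp
  cases hp with
  | nil => simp at hl
  | snoc hp hs =>
    obtain ⟨rfl, h2⟩ := List.append_inj' hl rfl
    simp only [List.cons.injEq, and_true] at h2
    exact ⟨_, hp, h2 ▸ hs⟩

theorem exists_of_append {l' : List (ℕ × ℕ)} (hp : Peel h (l ++ l') g) :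
    ∃ g₁, Peel h l g₁ ∧ Peel g₁ l' g := by
  induction l' using List.reverseRecOn generalizing g with
  | nil => exact ⟨g, by simpa using hp, nil⟩
  | append_singleton l' c ih =>
    rw [← List.append_assoc] at hp
    obtain ⟨g₂, h1, h2⟩ := hp.exists_of_snoc
    obtain ⟨g₁, h3, h4⟩ := ih h1
    exact ⟨g₁, h3, h4.snoc h2⟩

theorem exists_of_append_cons {l₁ l₂ : List (ℕ × ℕ)} {c : ℕ × ℕ} (hp : Peel h (l₁ ++ c :: l₂) g) :
    ∃ g₁ g₂, Peel h l₁ g₁ ∧ PeelStep g₁ c g₂ ∧ Peel g₂ l₂ g := by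
  rw [← List.singleton_append, ← List.append_assoc] at hp
  obtain ⟨g₂, h1, h2⟩ := hp.exists_of_append
  obtain ⟨g₁, h3, h4⟩ := h1.exists_of_snoc
  exact ⟨g₁, g₂, h3, h4, h2⟩

theorem isHeight (hh : IsHeight h) (hp : Peel h l g) : IsHeight g := by
  induction hp with
  | nil => exact hh
  | snoc _ hs ih => exact hs.isHeight ih

theorem le (hp : Peel h l g) (n : ℕ) : g n ≤ h n := by
  induction hp with
  | nil => exact le_rfl
  | @snoc l g g' c _ hs ih =>
    by_cases hn : n = c.1 + c.2 + 1
    · have h1 := hs.new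
      have h2 := hs.mid
      rw [← hn] at h1 h2
      omega
    · rwa [hs.other n hn]

/-- The cells that are removed are those between the two paths. -/
theorem mem_iff (hp : Peel h l g) (c : ℕ × ℕ) :
    c ∈ l ↔ g (c.1 + c.2 + 1) ≤ c.2 ∧ c.2 < h (c.1 + c.2 + 1) := by
  induction hp with
  | nil =>
    simp only [List.not_mem_nil, false_iff]
    omega
  | @snoc l g g' d hp hs ih =>
    rw [List.mem_append, List.mem_singleton, ih, Prod.ext_iff]
    have h1 := hs.new
    have h2 := hs.mid
    by_cases hn : c.1 + c.2 = d.1 + d.2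
    · have h3 := hp.le (c.1 + c.2 + 1)
      rw [hn] at h3 ⊢
      omega
    · rw [hs.other _ (by omega)]
      omega

theorem nodup (hp : Peel h l g) : l.Nodup := by
  induction hp with
  | nil => simp
  | @snoc l g g' c hp hs ih =>
    refine List.nodup_append.2 ⟨ih, by simp, fun d hd e he => ?_⟩
    rintro rfl
    rw [List.mem_singleton.1 he, hp.mem_iff, hs.mid] at hd
    omega

theorem diamond_subset (hh : IsHeight h) (hp : Peel h l g) {a a' b b' : ℕ}
    (ht : (a, b') ∈ l) (hb : (a', b) ∈ l) :
    Finset.Icc a a' ×ˢ Finset.Icc b b' ⊆ l.toFinset := by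
  rintro ⟨x, y⟩ hxy
  rw [Finset.mem_product, Finset.mem_Icc, Finset.mem_Icc] at hxy
  rw [List.mem_toFinset, hp.mem_iff]
  obtain ⟨-, h1⟩ := (hp.mem_iff _).1 ht
  obtain ⟨h2, -⟩ := (hp.mem_iff _).1 hb
  have hg := hp.isHeight hh
  dsimp only at *
  constructor
  · obtain h3 | h3 := le_total (x + y + 1) (a' + b + 1)
    · have := hg.le_of_le h3
      omega
    · have := hg.le_of_le h3
      omega
  · obtain h3 | h3 := le_total (x + y + 1) (a + b' + 1)
    · have := hh.le_of_le h3
      omega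
    · have := hh.le_of_le h3
      omega

end Peel

/-- The set `S` contains the top vertex of each diamond in the list whose left and right vertices it
contains. -/
def IsTopClosed (l : List (ℕ × ℕ)) (S : Finset (ℕ × ℕ)) : Prop :=
  ∀ a a' b b', a ≤ a' → b ≤ b' → Finset.Icc a a' ×ˢ Finset.Icc b b' ⊆ l.toFinset →
    (a, b) ∈ S → (a', b') ∈ S → (a, b') ∈ S

/-! ### Closure under top vertices implies positivity -/

/-- A condition on the `x`-th step of the path `g`, met by the pipe that leaves the crossing
`(a, b')` on its left side for as long as it stays left of the other pipe of that crossing. The pipe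
is still on the street `a`, or it has left it at an elbow `(a, b)` and is by now on an avenue not
right of `b`, or on a street and just below a cell of such an avenue. -/
def LeftOf (S : Finset (ℕ × ℕ)) (g : ℕ → ℕ) (a b' x : ℕ) : Prop :=
  (g (x + 1) = g x ∧ x = a + g x ∧ g x ≤ b') ∨ ∃ b < b', (a, b) ∈ S ∧ g x ≤ b

/-- The mirror image of `LeftOf`, for the pipe that leaves the crossing `(a, b')` on its right side,
along the avenue `b'` up to an elbow `(a', b')`. -/
def RightOf (S : Finset (ℕ × ℕ)) (g : ℕ → ℕ) (a b' y : ℕ) : Prop :=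
  (g (y + 1) = g y + 1 ∧ g y = b' ∧ a + b' < y) ∨ ∃ a' > a, (a', b') ∈ S ∧ g (y + 1) + a' ≤ y

section Step

variable {S : Finset (ℕ × ℕ)} {g g' : ℕ → ℕ} {c : ℕ × ℕ} {a b' x : ℕ}

theorem LeftOf.elbow (hs : PeelStep g c g') (hc : c ∈ S) (hx : LeftOf S g a b' x) :
    LeftOf S g' a b' x := by
  obtain ⟨a₂, b₂⟩ := c
  obtain ⟨h1, h2, h3, h4, h5⟩ := hs
  dsimp only at *
  by_cases hx1 : x = a₂ + b₂ + 1
  · subst hx1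
    obtain ⟨h6, h7, h8⟩ | ⟨b, h6, h7, h8⟩ := hx
    · obtain rfl : a = a₂ := by omega
      exact Or.inr ⟨b₂, by omega, hc, h4.le⟩
    · exact Or.inr ⟨b, h6, h7, by omega⟩
  · by_cases hx2 : x = a₂ + b₂
    · subst hx2
      obtain ⟨h6, h7, h8⟩ | ⟨b, h6, h7, h8⟩ := hx
      · omega
      · exact Or.inr ⟨b, h6, h7, by rwa [h5 _ hx1]⟩
    · unfold LeftOf
      rwa [h5 x hx1, h5 (x + 1) (by omega)]

theorem RightOf.elbow (hs : PeelStep g c g') (hc : c ∈ S) (hx : RightOf S g a b' x) :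
    RightOf S g' a b' x := by
  obtain ⟨a₂, b₂⟩ := c
  obtain ⟨h1, h2, h3, h4, h5⟩ := hs
  dsimp only at *
  by_cases hx1 : x = a₂ + b₂ + 1
  · subst hx1
    obtain ⟨h6, h7, h8⟩ | ⟨a', h6, h7, h8⟩ := hx
    · omega
    · exact Or.inr ⟨a', h6, h7, by rwa [h5 _ (by omega)]⟩
  · by_cases hx2 : x = a₂ + b₂
    · subst hx2
      obtain ⟨h6, h7, h8⟩ | ⟨a', h6, h7, h8⟩ := hx
      · obtain rfl : b' = b₂ := by omega
        exact Or.inr ⟨a₂, by omega, hc, by omega⟩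
      · exact Or.inr ⟨a', h6, h7, by omega⟩
    · unfold RightOf
      rwa [h5 x hx1, h5 (x + 1) (by omega)]

theorem LeftOf.crossing (hs : PeelStep g c g') (hx : LeftOf S g a b' x) :
    LeftOf S g' a b' (if x = c.1 + c.2 then c.1 + c.2 + 1 else
      if x = c.1 + c.2 + 1 then c.1 + c.2 else x) := by
  obtain ⟨a₂, b₂⟩ := c
  obtain ⟨h1, h2, h3, h4, h5⟩ := hs
  dsimp only at *
  have h6 := h5 (a₂ + b₂) (by omega)
  split_ifs with hx1 hx2
  · subst hx1
    obtain ⟨_, _, _⟩ | ⟨b, _, hb, _⟩ := hx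
    · omega
    · exact Or.inr ⟨b, by omega, hb, by omega⟩
  · subst hx2
    obtain ⟨_, _, _⟩ | ⟨b, _, hb, _⟩ := hx
    · exact Or.inl (by omega)
    · exact Or.inr ⟨b, by omega, hb, by omega⟩
  · unfold LeftOf
    rwa [h5 x hx2, h5 (x + 1) (by omega)]

theorem RightOf.crossing (hs : PeelStep g c g') (hx : RightOf S g a b' x) :
    RightOf S g' a b' (if x = c.1 + c.2 then c.1 + c.2 + 1 else
      if x = c.1 + c.2 + 1 then c.1 + c.2 else x) := by
  obtain ⟨a₂, b₂⟩ := c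
  obtain ⟨h1, h2, h3, h4, h5⟩ := hs
  dsimp only at *
  have h6 := h5 (a₂ + b₂ + 1 + 1) (by omega)
  split_ifs with hx1 hx2
  · subst hx1
    unfold RightOf
    obtain ⟨_, _, _⟩ | ⟨a', _, ha, _⟩ := hx
    · exact Or.inl (by omega)
    · exact Or.inr ⟨a', by omega, ha, by omega⟩
  · subst hx2
    unfold RightOf at hx
    obtain ⟨_, _, _⟩ | ⟨a', _, ha, _⟩ := hx
    · omega
    · exact Or.inr ⟨a', by omega, ha, by omega⟩
  · unfold RightOf
    rwa [h5 x hx2, h5 (x + 1) (by omega)]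

end Step

/-- After the cells of `l` have been passed, each pair of pipes that are out of order comes from a
crossing in `l`, and the two pipes are still where `LeftOf` and `RightOf` locate them. -/
def InversionsLocated (m : ℕ) (S : Finset (ℕ × ℕ)) (l : List (ℕ × ℕ)) (g : ℕ → ℕ) : Prop :=
  ∀ i j : Fin m, i < j → listFlow m S l j < listFlow m S l i →
    ∃ a b', (a, b') ∈ l ∧ (a, b') ∉ S ∧
      LeftOf S g a b' (listFlow m S l j) ∧ RightOf S g a b' (listFlow m S l i)

/-- Two pipes that are out of order cannot meet again: when they do, both have turned at an elbow
since their crossing, and the crossing is the top vertex of a diamond whose left and right vertices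
are these elbows. -/
theorem InversionsLocated.ascent {m : ℕ} {S : Finset (ℕ × ℕ)} {h g g₁ g₂ : ℕ → ℕ}
    {l l₁ : List (ℕ × ℕ)} {c : ℕ × ℕ} (hh : IsHeight h) (hp : Peel h l g) (hS : IsTopClosed l S)
    (hl₁ : l₁ ⊆ l) (hc : c ∈ l) (hs : PeelStep g₁ c g₂) (hi : InversionsLocated m S l₁ g₁) :
    Ascent (c.1 + c.2) (listFlow m S l₁) := by
  intro i j hi' hj'
  by_contra hij
  have hne : i ≠ j := fun e => by
    subst e
    omega
  obtain ⟨a, b', hT, hTS, hL, hR⟩ := hi j i (by omega) (by rw [Fin.lt_def]; omega)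
  obtain ⟨a₂, b₂⟩ := c
  obtain ⟨h1, h2, h3, -, -⟩ := hs
  dsimp only at *
  rw [hi'] at hL
  rw [hj'] at hR
  obtain ⟨_, _, _⟩ | ⟨b, hb, hLS, hb₂⟩ := hL
  · omega
  unfold RightOf at hR
  obtain ⟨_, _, _⟩ | ⟨a', ha, hRS, ha₂⟩ := hR
  · omega
  refine hTS (hS a a' b b' ha.le hb.le (Finset.Subset.trans ?_ (hp.diamond_subset hh (hl₁ hT) hc))
    hLS hRS)
  exact Finset.product_subset_product (Finset.Icc_subset_Icc le_rfl (by omega))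
    (Finset.Icc_subset_Icc (by omega) le_rfl)

theorem InversionsLocated.step {m : ℕ} {S : Finset (ℕ × ℕ)} {g g' : ℕ → ℕ}
    {l : List (ℕ × ℕ)} {c : ℕ × ℕ} (hm : c.1 + c.2 + 1 < m) (hs : PeelStep g c g')
    (hi : InversionsLocated m S l g) (ha : Ascent (c.1 + c.2) (listFlow m S l)) :
    InversionsLocated m S (l ++ [c]) g' := by
  intro i j hij hinv
  rw [listFlow_append_singleton] at hinv ⊢
  by_cases hc : c ∈ S
  · rw [if_pos hc] at hinv ⊢
    obtain ⟨a, b', h1, h2, h3, h4⟩ := hi i j hij hinv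
    exact ⟨a, b', by simp [h1], h2, h3.elbow hs hc, h4.elbow hs hc⟩
  · rw [if_neg hc] at hinv ⊢
    rw [Fin.lt_def] at hinv
    simp only [Equiv.Perm.mul_apply, adjSwap_val hm] at hinv ⊢
    by_cases hlt : listFlow m S l j < listFlow m S l i
    · obtain ⟨a, b', h1, h2, h3, h4⟩ := hi i j hij hlt
      exact ⟨a, b', by simp [h1], h2, h3.crossing hs, h4.crossing hs⟩
    · -- the pipes cross at `c`
      have hne : (listFlow m S l i : ℕ) ≠ listFlow m S l j := fun e =>
        hij.ne (eq_of_val_eq _ e)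
      rw [Fin.lt_def] at hlt
      have h1 : (listFlow m S l i : ℕ) = c.1 + c.2 ∧ (listFlow m S l j : ℕ) = c.1 + c.2 + 1 := by
        split_ifs at hinv <;> omega
      rw [h1.1, h1.2]
      obtain ⟨a₂, b₂⟩ := c
      obtain ⟨g1, g2, g3, g4, g5⟩ := hs
      dsimp only at *
      have g6 := g5 (a₂ + b₂) (by omega)
      have g7 := g5 (a₂ + b₂ + 1 + 1) (by omega)
      refine ⟨a₂, b₂, by simp, hc, Or.inl ?_, Or.inl ?_⟩
      · simp
        omega
      · simp
        omega

theorem IsTopClosed.isPositive {m : ℕ} {S : Finset (ℕ × ℕ)} {h g : ℕ → ℕ} {l : List (ℕ × ℕ)}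
    (hS : IsTopClosed l S) (hh : IsHeight h) (hp : Peel h l g)
    (hm : ∀ c ∈ l, c.1 + c.2 + 1 < m) : IsPositive m S l := by
  have key : ∀ l₁ g₁, Peel h l₁ g₁ → l₁ ⊆ l → InversionsLocated m S l₁ g₁ := by
    intro l₁ g₁ hp₁
    induction hp₁ with
    | nil =>
      intro _ i j hij hinv
      simp only [listFlow, List.filter_nil, List.foldl_nil, Equiv.Perm.one_apply] at hinv
      exact absurd hij hinv.asymm
    | @snoc l₁ g₁ g₂ c _ hs ih =>
      intro hl
      have hl₁ : l₁ ⊆ l := fun d hd => hl (by simp [hd])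
      have hc : c ∈ l := hl (by simp)
      exact (ih hl₁).step (hm c hc) hs ((ih hl₁).ascent hh hp hS hl₁ hc hs)
  rintro l₁ c l₂ rfl
  obtain ⟨g₁, g₂, h1, h2, -⟩ := hp.exists_of_append_cons
  have hl₁ : l₁ ⊆ l₁ ++ c :: l₂ := fun d hd => by simp [hd]
  exact (key l₁ g₁ h1 hl₁).ascent hh hp hS hl₁ (by simp) h2

/-! ### Positivity implies closure under top vertices -/

/-- The left boundary of the diamond `[a, a'] × [b, b']`, from the top vertex along the street `a`
to the left vertex and then along the avenue `b` to the bottom vertex: the `x`-th step of the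
path `g` crosses it. -/
def OnLeftBoundary (a a' b b' : ℕ) (g : ℕ → ℕ) (x : ℕ) : Prop :=
  (g (x + 1) = g x ∧ x = a + g x ∧ b < g x ∧ g x ≤ b') ∨
    (g (x + 1) = g x + 1 ∧ g x = b ∧ a + b < x ∧ x ≤ a' + b)

/-- The right boundary of the diamond `[a, a'] × [b, b']`, from the top vertex along the avenue `b'`
to the right vertex and then along the street `a'` to the bottom vertex: the `y`-th step of the
path `g` crosses it. -/
def OnRightBoundary (a a' b b' : ℕ) (g : ℕ → ℕ) (y : ℕ) : Prop :=
  (g (y + 1) = g y + 1 ∧ g y = b' ∧ a + b' < y ∧ y ≤ a' + b') ∨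
    (g (y + 1) = g y ∧ y = a' + g y ∧ b < g y ∧ g y ≤ b')

section Boundary

variable {m : ℕ} {S : Finset (ℕ × ℕ)} {g g' : ℕ → ℕ} {l : List (ℕ × ℕ)} {c : ℕ × ℕ}
  {a a' b b' : ℕ} {p : Fin m}

theorem OnLeftBoundary.step (hm : c.1 + c.2 + 1 < m) (hs : PeelStep g c g') (ha : a < a')
    (hL : (a, b) ∈ S) (h₁ : ∀ y, b < y → y < b' → (a, y) ∉ S)
    (h₂ : ∀ x, a < x → x < a' → (x, b) ∉ S) (hc : c ≠ (a', b))
    (hp : OnLeftBoundary a a' b b' g (listFlow m S l p)) :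
    OnLeftBoundary a a' b b' g' (listFlow m S (l ++ [c]) p) := by
  rw [listFlow_append_singleton]
  generalize listFlow m S l = π at *
  obtain ⟨a₂, b₂⟩ := c
  obtain ⟨g1, g2, g3, g4, g5⟩ := hs
  dsimp only at *
  have g6 := g5 (a₂ + b₂) (by omega)
  have g7 := g5 (a₂ + b₂ + 1 + 1) (by omega)
  by_cases hx1 : (π p : ℕ) = a₂ + b₂ + 1
  · rw [hx1] at hp
    unfold OnLeftBoundary at hp
    obtain ⟨_, _, _, _⟩ | ⟨_, _, _, _⟩ := hp
    · obtain rfl : a = a₂ := by omega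
      by_cases hb : b₂ = b
      · subst hb
        rw [if_pos hL, hx1]
        exact Or.inr (by omega)
      · rw [if_neg (h₁ b₂ (by omega) (by omega)), Equiv.Perm.mul_apply, adjSwap_val (by omega),
          if_neg (by omega), if_pos (by omega)]
        exact Or.inl (by omega)
    · omega
  by_cases hx2 : (π p : ℕ) = a₂ + b₂
  · rw [hx2] at hp
    obtain ⟨_, _, _, _⟩ | ⟨_, _, _, _⟩ := hp
    · omega
    · obtain rfl : b = b₂ := by omega
      have ha₂ : a₂ ≠ a' := fun e => hc (by rw [e])
      rw [if_neg (h₂ a₂ (by omega) (by omega)), Equiv.Perm.mul_apply, adjSwap_val (by omega),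
        if_pos hx2]
      exact Or.inr (by omega)
  · have h3 : (((if (a₂, b₂) ∈ S then π else adjSwap m (a₂ + b₂) * π) p : Fin m) : ℕ) = π p := by
      split_ifs
      · rfl
      · rw [Equiv.Perm.mul_apply, adjSwap_val (by omega), if_neg hx2, if_neg hx1]
    rw [h3]
    unfold OnLeftBoundary
    rwa [g5 _ hx1, g5 (π p + 1) (by omega)]

theorem OnRightBoundary.step (hm : c.1 + c.2 + 1 < m) (hs : PeelStep g c g') (hb : b < b')
    (hR : (a', b') ∈ S) (h₁ : ∀ x, a < x → x < a' → (x, b') ∉ S)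
    (h₂ : ∀ y, b < y → y < b' → (a', y) ∉ S) (hc : c ≠ (a', b))
    (hp : OnRightBoundary a a' b b' g (listFlow m S l p)) :
    OnRightBoundary a a' b b' g' (listFlow m S (l ++ [c]) p) := by
  rw [listFlow_append_singleton]
  generalize listFlow m S l = π at *
  obtain ⟨a₂, b₂⟩ := c
  obtain ⟨g1, g2, g3, g4, g5⟩ := hs
  dsimp only at *
  have g6 := g5 (a₂ + b₂) (by omega)
  have g7 := g5 (a₂ + b₂ + 1 + 1) (by omega)
  by_cases hx1 : (π p : ℕ) = a₂ + b₂ + 1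
  · rw [hx1] at hp
    unfold OnRightBoundary at hp
    obtain ⟨_, _, _, _⟩ | ⟨_, _, _, _⟩ := hp
    · omega
    · obtain rfl : a' = a₂ := by omega
      have hb₂ : b₂ ≠ b := fun e => hc (by rw [e])
      rw [if_neg (h₂ b₂ (by omega) (by omega)), Equiv.Perm.mul_apply, adjSwap_val (by omega),
        if_neg (by omega), if_pos (by omega)]
      exact Or.inr (by omega)
  by_cases hx2 : (π p : ℕ) = a₂ + b₂
  · rw [hx2] at hp
    obtain ⟨_, _, _, _⟩ | ⟨_, _, _, _⟩ := hp
    · obtain rfl : b' = b₂ := by omega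
      by_cases ha : a₂ = a'
      · subst ha
        rw [if_pos hR, hx2]
        exact Or.inr (by omega)
      · rw [if_neg (h₁ a₂ (by omega) (by omega)), Equiv.Perm.mul_apply, adjSwap_val (by omega),
          if_pos hx2]
        exact Or.inl (by omega)
    · omega
  · have h3 : (((if (a₂, b₂) ∈ S then π else adjSwap m (a₂ + b₂) * π) p : Fin m) : ℕ) = π p := by
      split_ifs
      · rfl
      · rw [Equiv.Perm.mul_apply, adjSwap_val (by omega), if_neg hx2, if_neg hx1]
    rw [h3]
    unfold OnRightBoundary
    rwa [g5 _ hx1, g5 (π p + 1) (by omega)]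

theorem OnLeftBoundary.eq_of_peelStep {x : ℕ} (hg : IsHeight g) (hs : PeelStep g (a', b) g')
    (ha : a < a') (hx : OnLeftBoundary a a' b b' g x) : x = a' + b := by
  obtain ⟨g1, g2, g3, -, -⟩ := hs
  dsimp only at *
  obtain ⟨h1, h2, h3, h4⟩ | ⟨h1, h2, h3, h4⟩ := hx
  · obtain h5 | h5 := le_total x (a' + b)
    · have := hg.le_of_le h5
      omega
    · have := hg.le_of_le h5
      omega
  · obtain h5 | h5 | h5 := lt_trichotomy x (a' + b)
    · have := hg.le_of_le (Nat.succ_le_of_lt h5)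
      simp only [Nat.succ_eq_add_one] at this
      omega
    · exact h5
    · omega

theorem OnRightBoundary.eq_of_peelStep {y : ℕ} (hg : IsHeight g) (hs : PeelStep g (a', b) g')
    (hb : b < b') (hy : OnRightBoundary a a' b b' g y) : y = a' + b + 1 := by
  obtain ⟨g1, g2, g3, -, -⟩ := hs
  dsimp only at *
  obtain ⟨h1, h2, h3, h4⟩ | ⟨h1, h2, h3, h4⟩ := hy
  · obtain h5 | h5 | h5 := lt_trichotomy y (a' + b + 1)
    · have := hg.le_of_le (Nat.le_of_lt_succ h5)
      omega
    · exact h5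
    · have := hg.le_of_le (Nat.succ_le_of_lt h5)
      simp only [Nat.succ_eq_add_one] at this
      omega
  · obtain h5 | h5 | h5 := lt_trichotomy y (a' + b + 1)
    · omega
    · exact h5
    · have := hg.le_of_le (Nat.succ_le_of_lt h5)
      simp only [Nat.succ_eq_add_one] at this
      omega

end Boundary

/-- For a diamond of minimal size whose left and right vertices are in `S`, but whose top vertex is
not, all other cells on its boundary, except perhaps the bottom vertex, are crossings. So the two
pipes that cross at the top vertex run along the boundary, turn at the left and the right vertex,
and meet a second time at the bottom vertex. -/
theorem IsPositive.isTopClosed {m : ℕ} {S : Finset (ℕ × ℕ)} {h g : ℕ → ℕ} {l : List (ℕ × ℕ)}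
    (hS : IsPositive m S l) (hh : IsHeight h) (hp : Peel h l g)
    (hm : ∀ c ∈ l, c.1 + c.2 + 1 < m) : IsTopClosed l S := by
  intro a a' b b' ha hb hD hL hR
  induction hn : (a' - a) + (b' - b) using Nat.strong_induction_on generalizing a a' b b' with
  | _ n ih =>
  obtain rfl | ha := ha.eq_or_lt
  · exact hR
  obtain rfl | hb := hb.eq_or_lt
  · exact hL
  by_contra hT
  have sub : ∀ {a₁ a₁' b₁ b₁'}, a ≤ a₁ → a₁' ≤ a' → b ≤ b₁ → b₁' ≤ b' →
      Finset.Icc a₁ a₁' ×ˢ Finset.Icc b₁ b₁' ⊆ l.toFinset := fun h1 h2 h3 h4 =>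
    Finset.Subset.trans (Finset.product_subset_product (Finset.Icc_subset_Icc h1 h2)
      (Finset.Icc_subset_Icc h3 h4)) hD
  -- in each of the four cases, an elbow on an edge would give a smaller diamond of the same kind
  have e1 : ∀ y, b < y → y < b' → (a, y) ∉ S := fun y h1 h2 h3 =>
    hT (ih _ (by omega) a a' y b' ha.le h2.le (sub le_rfl le_rfl h1.le le_rfl) h3 hR rfl)
  have e2 : ∀ x, a < x → x < a' → (x, b') ∉ S := fun x h1 h2 h3 =>
    hT (ih _ (by omega) a x b b' h1.le hb.le (sub le_rfl h2.le le_rfl le_rfl) hL h3 rfl)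
  have e3 : ∀ x, a < x → x < a' → (x, b) ∉ S := fun x h1 h2 h3 =>
    e2 x h1 h2 (ih _ (by omega) x a' b b' h2.le hb.le (sub h1.le le_rfl le_rfl le_rfl) h3 hR rfl)
  have e4 : ∀ y, b < y → y < b' → (a', y) ∉ S := fun y h1 h2 h3 =>
    e1 y h1 h2 (ih _ (by omega) a a' b y ha.le h1.le (sub le_rfl le_rfl le_rfl h2.le) hL h3 rfl)
  have hTl : (a, b') ∈ l := List.mem_toFinset.1 (hD (by simp [ha.le, hb.le]))
  have hBl : (a', b) ∈ l := List.mem_toFinset.1 (hD (by simp [ha.le, hb.le]))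
  have hn := hp.nodup
  obtain ⟨l₁, l₂, rfl⟩ := List.append_of_mem hTl
  obtain ⟨g₁, g₂, p1, s1, p2⟩ := hp.exists_of_append_cons
  have hBl₂ : (a', b) ∈ l₂ := by
    simp only [List.mem_append, List.mem_cons, Prod.mk.injEq] at hBl
    obtain hB | hB | hB := hBl
    · -- the bottom vertex does not precede the top vertex
      have h1 := ((p1.mem_iff _).1 hB).1
      have h2 := s1.mid
      have h3 := p1.isHeight hh
      dsimp only at h1 h2
      obtain h4 | h4 := le_total (a + b' + 1) (a' + b + 1)
      · have := h3.le_of_le h4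
        omega
      · have := h3.le_of_le h4
        omega
    · omega
    · exact hB
  obtain ⟨l₃, l₄, rfl⟩ := List.append_of_mem hBl₂
  obtain ⟨g₃, g₄, p3, s2, -⟩ := p2.exists_of_append_cons
  have hB₃ : (a', b) ∉ l₃ := by
    intro h1
    rw [List.nodup_append, List.nodup_cons, List.nodup_append] at hn
    exact hn.2.1.2.2.2 _ h1 (a', b) (by simp) rfl
  have hk : a + b' + 1 < m := hm (a, b') (by simp)
  obtain ⟨i, hi⟩ := exists_val_eq (listFlow m S l₁) (k := a + b') (by omega)
  obtain ⟨j, hj⟩ := exists_val_eq (listFlow m S l₁) hk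
  have hij := hS l₁ _ _ rfl i j hi hj
  have track : ∀ l' g', Peel g₂ l' g' → l' ⊆ l₃ →
      OnLeftBoundary a a' b b' g' (listFlow m S (l₁ ++ [(a, b')] ++ l') j) ∧
      OnRightBoundary a a' b b' g' (listFlow m S (l₁ ++ [(a, b')] ++ l') i) := by
    intro l' g' hp'
    induction hp' with
    | nil =>
      intro _
      rw [List.append_nil, listFlow_append_singleton, if_neg hT, Equiv.Perm.mul_apply,
        Equiv.Perm.mul_apply, adjSwap_val hk, adjSwap_val hk, hi, hj]
      obtain ⟨g1, g2, g3, g4, g5⟩ := s1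
      dsimp only at *
      have g6 := g5 (a + b') (by omega)
      have g7 := g5 (a + b' + 1 + 1) (by omega)
      constructor
      · left
        simp
        omega
      · left
        simp
        omega
    | @snoc l' g' g'' c _ hs ih' =>
      intro hl'
      obtain ⟨h1, h2⟩ := ih' fun d hd => hl' (by simp [hd])
      have hc : c ∈ l₃ := hl' (by simp)
      have hcB : c ≠ (a', b) := fun e => hB₃ (e ▸ hc)
      have hcm := hm c (by simp [hc])
      rw [← List.append_assoc]
      exact ⟨h1.step hcm hs ha hL e1 e3 hcB, h2.step hcm hs hb hR e2 e4 hcB⟩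
  -- at the bottom vertex the pipes of `i` and `j` meet, with `j` on the left although `i < j`
  obtain ⟨t1, t2⟩ := track l₃ g₃ p3 (List.Subset.refl _)
  have hg₃ : IsHeight g₃ := p3.isHeight (s1.isHeight (p1.isHeight hh))
  have := hS (l₁ ++ [(a, b')] ++ l₃) (a', b) l₄ (by simp) j i (t1.eq_of_peelStep hg₃ s2 ha)
    (t2.eq_of_peelStep hg₃ s2 hb)
  exact hij.asymm this

/-! ### The bijection for a list of cells -/

theorem isTopClosed_empty (l : List (ℕ × ℕ)) : IsTopClosed l ∅ := by
  intro a a' b b' _ _ _ h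
  simp at h

theorem Peel.bijOn_listFlow {m : ℕ} {h g : ℕ → ℕ} {l : List (ℕ × ℕ)} (hh : IsHeight h)
    (hp : Peel h l g) (hm : ∀ c ∈ l, c.1 + c.2 + 1 < m) :
    Set.BijOn (fun S => listFlow m S l) {S | S ⊆ l.toFinset ∧ IsTopClosed l S}
      {σ | BruhatLE σ (listFlow m ∅ l)} := by
  have h1 : {S | S ⊆ l.toFinset ∧ IsTopClosed l S} = {S | S ⊆ l.toFinset ∧ IsPositive m S l} :=
    Set.ext fun S => and_congr_right fun _ =>
      ⟨fun hS => hS.isPositive hh hp hm, fun hS => hS.isTopClosed hh hp hm⟩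
  rw [h1]
  exact bijOn_listFlow_isPositive hm hp.nodup ((isTopClosed_empty l).isPositive hh hp hm)

theorem Peel.card_add_invCount {m : ℕ} {h g : ℕ → ℕ} {l : List (ℕ × ℕ)} (hh : IsHeight h)
    (hp : Peel h l g) (hm : ∀ c ∈ l, c.1 + c.2 + 1 < m) {S : Finset (ℕ × ℕ)}
    (hSl : S ⊆ l.toFinset) (hS : IsTopClosed l S) :
    S.card + invCount (listFlow m S l) = invCount (listFlow m ∅ l) :=
  IsPositive.card_add_invCount hm hp.nodup ((isTopClosed_empty l).isPositive hh hp hm)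
    (hS.isPositive hh hp hm) hSl

/-! ### Reflection in a horizontal line -/

/-- The list of the mirror images of the cells, in reverse order. The reflection in a horizontal
line exchanges streets and avenues, top and bottom. -/
def reflectList (l : List (ℕ × ℕ)) : List (ℕ × ℕ) :=
  (l.map Prod.swap).reverse

theorem mem_reflectList {l : List (ℕ × ℕ)} {c : ℕ × ℕ} : c ∈ reflectList l ↔ c.swap ∈ l := by
  unfold reflectList
  rw [List.mem_reverse, List.mem_map]
  exact ⟨by rintro ⟨d, hd, rfl⟩; simpa using hd, fun h => ⟨_, h, by simp⟩⟩

theorem IsHeight.reflect {h : ℕ → ℕ} (hh : IsHeight h) : IsHeight fun n => n - h n := by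
  intro n
  have := hh n
  dsimp only
  omega

theorem PeelStep.reflect {g g' : ℕ → ℕ} {c : ℕ × ℕ} (hs : PeelStep g c g') :
    PeelStep (fun n => n - g' n) c.swap (fun n => n - g n) := by
  obtain ⟨a, b⟩ := c
  obtain ⟨h1, h2, h3, h4, h5⟩ := hs
  simp only at *
  have h6 := h5 (a + b) (by omega)
  have h7 := h5 (a + b + 1 + 1) (by omega)
  constructor <;> simp only [Prod.swap, Nat.add_comm b a]
  · omega
  · omega
  · omega
  · omega
  · intro n hn
    rw [h5 n hn]

theorem Peel.reflect {h g : ℕ → ℕ} {l : List (ℕ × ℕ)} (hp : Peel h l g) :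
    Peel (fun n => n - g n) (reflectList l) (fun n => n - h n) := by
  induction hp with
  | nil => exact Peel.nil
  | @snoc l g g' c _ hs ih =>
    have h1 : reflectList (l ++ [c]) = ([] ++ [c.swap]) ++ reflectList l := by
      simp [reflectList]
    rw [h1]
    exact (Peel.nil.snoc hs.reflect).append ih

theorem listFlow_reflectList (m : ℕ) (S : Finset (ℕ × ℕ)) (l : List (ℕ × ℕ)) :
    listFlow m (S.image Prod.swap) (reflectList l) = (listFlow m S l)⁻¹ := by
  rw [← wordProd_crossingWord, ← wordProd_crossingWord, ← wordProd_reverse]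
  congr 1
  unfold crossingWord reflectList
  rw [List.reverse_reverse, List.filter_reverse, List.map_reverse, List.reverse_reverse,
    List.filter_map, List.map_map]
  have h1 : ∀ c : ℕ × ℕ, c.swap ∈ S.image Prod.swap ↔ c ∈ S := fun c => by
    rw [Finset.mem_image]
    exact ⟨by rintro ⟨d, hd, e⟩; rwa [← Prod.swap_injective e], fun h => ⟨c, h, rfl⟩⟩
  rw [List.filter_congr (q := fun c => decide (c ∉ S)) fun c _ => by
    simp only [Function.comp_apply, h1]]
  exact List.map_congr_left fun c _ => Nat.add_comm _ _

/-! ### The list of the cells of a staircase polyomino -/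

theorem isHeight_upCount {m : ℕ} (w : Fin m → Bool) : IsHeight (upCount w) := by
  intro n
  unfold upCount
  constructor
  · refine Finset.card_le_card fun i hi => ?_
    simp only [Finset.mem_filter, Finset.mem_univ, true_and] at hi ⊢
    exact ⟨by omega, hi.2⟩
  · have h1 : (Finset.univ.filter fun i : Fin m => (i : ℕ) = n).card ≤ 1 :=
      Finset.card_le_one.2 fun i hi j hj => by
        simp only [Finset.mem_filter, Finset.mem_univ, true_and] at hi hj
        exact Fin.ext (by omega)
    refine le_trans (Finset.card_le_card fun i hi => ?_)
      ((Finset.card_union_le _ _).trans (Nat.add_le_add_left h1 _))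
    simp only [Finset.mem_filter, Finset.mem_univ, true_and, Finset.mem_union] at hi ⊢
    rcases Nat.lt_succ_iff_lt_or_eq.1 hi.1 with h | h
    · exact Or.inl ⟨h, hi.2⟩
    · exact Or.inr h

theorem upCount_zero {m : ℕ} (w : Fin m → Bool) : upCount w 0 = 0 := by
  simp [upCount]

theorem upCount_le {m : ℕ} (w : Fin m → Bool) (n : ℕ) : upCount w n ≤ n := by
  have := (isHeight_upCount w).le_of_le (Nat.zero_le n)
  rw [upCount_zero] at this
  omega

theorem upCount_of_le {m : ℕ} (w : Fin m → Bool) {n : ℕ} (hn : m ≤ n) :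
    upCount w n = upCount w m := by
  unfold upCount
  congr 1
  ext i
  have := i.isLt
  simp only [Finset.mem_filter, Finset.mem_univ, true_and]
  constructor <;> rintro ⟨_, h⟩ <;> exact ⟨by omega, h⟩

namespace StaircasePolyomino

variable {m : ℕ} (P : StaircasePolyomino m)

theorem bot_le_top (n : ℕ) : upCount P.bot n ≤ upCount P.top n := by
  obtain rfl | hn := Nat.eq_zero_or_pos n
  · rw [upCount_zero, upCount_zero]
  · obtain h | h := lt_or_ge n m
    · exact (P.bot_lt_top n hn h).le
    · rw [upCount_of_le _ h, upCount_of_le _ h, P.same_end]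

theorem HasCell.lt {P : StaircasePolyomino m} {c : ℕ × ℕ} (h : P.HasCell c) :
    c.1 + c.2 + 1 < m := by
  by_contra hc
  obtain ⟨h1, h2⟩ := h
  rw [upCount_of_le _ (not_lt.1 hc)] at h1 h2
  have := P.same_end
  omega

/-- The lower boundary of the region formed by the cells of `P` on the streets before `a` and by
those on the street `a` with avenue at least `b`. Where it does not follow the top or the bottom
path, it follows the lower boundary of the same region of the whole grid. -/
def frontier (a b n : ℕ) : ℕ :=
  max (upCount P.bot n) (min (upCount P.top n) (if n ≤ a + b then n - a else n - (a + 1)))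

theorem peelStep_frontier {a b : ℕ} (hc : P.HasCell (a, b)) :
    PeelStep (P.frontier a (b + 1)) (a, b) (P.frontier a b) := by
  obtain ⟨h1, h2⟩ := hc
  have t1 := isHeight_upCount P.top (a + b)
  have t2 := isHeight_upCount P.top (a + b + 1)
  have b1 := isHeight_upCount P.bot (a + b)
  have b2 := isHeight_upCount P.bot (a + b + 1)
  dsimp only at *
  constructor <;> simp only [frontier]
  · rw [if_pos (by omega)]
    omega
  · rw [if_pos (by omega)]
    omega
  · rw [if_neg (by omega)]
    omega
  · rw [if_neg (by omega)]
    omega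
  · intro n hn
    congr 2
    split_ifs <;> omega

theorem frontier_succ_of_not_hasCell {a b : ℕ} (hc : ¬ P.HasCell (a, b)) :
    P.frontier a (b + 1) = P.frontier a b := by
  funext n
  unfold frontier
  by_cases hn : n = a + b + 1
  · subst hn
    unfold HasCell at hc
    have := P.bot_le_top (a + b + 1)
    rw [if_pos (by omega), if_neg (by omega)]
    dsimp only at hc
    omega
  · congr 2
    split_ifs <;> omega

theorem peel_street (a b : ℕ) :
    Peel (P.frontier a b) (((List.range b).reverse.map fun b => (a, b)).filter fun c => P.HasCell c)
      (P.frontier a 0) := by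
  induction b with
  | zero => exact Peel.nil
  | succ b ih =>
    rw [List.range_succ, List.reverse_append, List.reverse_singleton, List.map_append,
      List.filter_append]
    refine Peel.append ?_ ih
    by_cases hc : P.HasCell (a, b)
    · simpa [hc] using Peel.nil.snoc (P.peelStep_frontier hc)
    · simpa [hc, P.frontier_succ_of_not_hasCell hc] using Peel.nil

theorem frontier_zero_eq (a : ℕ) : P.frontier a 0 = P.frontier (a + 1) m := by
  funext n
  unfold frontier
  obtain hn | hn := le_total m n
  · have := P.same_end
    rw [upCount_of_le _ hn, upCount_of_le _ hn]
    omega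
  · congr 2
    split_ifs <;> omega

theorem peel_streets (a : ℕ) :
    Peel (P.frontier 0 m) (((List.range a).flatMap fun a =>
      (List.range m).reverse.map fun b => (a, b)).filter fun c => P.HasCell c)
      (P.frontier a m) := by
  induction a with
  | zero => exact Peel.nil
  | succ a ih =>
    rw [List.range_succ, List.flatMap_append, List.filter_append, List.flatMap_singleton,
      ← frontier_zero_eq]
    exact ih.append (P.peel_street a m)

theorem peel_cellList : Peel (upCount P.top) P.cellList (upCount P.bot) := by
  have h1 : P.frontier 0 m = upCount P.top := by
    funext n
    unfold frontier
    have := P.bot_le_top n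
    have := upCount_le P.top n
    obtain hn | hn := le_total m n
    · have := P.same_end
      rw [upCount_of_le _ hn, upCount_of_le _ hn]
      omega
    · rw [if_pos (by omega)]
      omega
  have h2 : P.frontier m m = upCount P.bot := by
    funext n
    unfold frontier
    obtain hn | hn := le_total m n
    · have := P.same_end
      rw [upCount_of_le _ hn, upCount_of_le _ hn]
      omega
    · rw [if_pos (by omega)]
      omega
  have := P.peel_streets m
  rwa [h1, h2] at this

theorem lt_of_mem_cellList {c : ℕ × ℕ} (hc : c ∈ P.cellList) : c.1 + c.2 + 1 < m :=
  ((P.mem_cells c).1 (List.mem_toFinset.2 hc)).lt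

theorem lt_of_mem_reflectList {c : ℕ × ℕ} (hc : c ∈ reflectList P.cellList) :
    c.1 + c.2 + 1 < m := by
  have := P.lt_of_mem_cellList (mem_reflectList.1 hc)
  simp only [Prod.fst_swap, Prod.snd_swap] at this
  omega

theorem topClosed_eq : P.topClosed = {S | S ⊆ P.cellList.toFinset ∧ IsTopClosed P.cellList S} := by
  ext S
  simp only [topClosed, IsTopClosed, DiamondFits, cells, and_imp]

theorem mem_bottomClosed_iff {S : Finset (ℕ × ℕ)} :
    S ∈ P.bottomClosed ↔ S.image Prod.swap ⊆ (reflectList P.cellList).toFinset ∧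
      IsTopClosed (reflectList P.cellList) (S.image Prod.swap) := by
  have h1 : ∀ a b : ℕ, (a, b) ∈ S.image Prod.swap ↔ (b, a) ∈ S := fun a b => by
    simp
  have h2 : ∀ {a b : ℕ}, (a, b) ∈ (reflectList P.cellList).toFinset ↔ (b, a) ∈ P.cells := by
    simp [mem_reflectList, cells]
  simp only [bottomClosed, IsTopClosed, DiamondFits, h1, Set.mem_ofPred_eq]
  refine and_congr ⟨fun h c hc => ?_, fun h c hc => ?_⟩
    ⟨fun h a a' b b' ha hb hD hL hR => ?_, fun h a a' b b' hD hL hR => ?_⟩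
  · exact h2.2 (h ((h1 c.1 c.2).1 hc))
  · exact h2.1 (h ((h1 c.2 c.1).2 hc))
  · refine h b b' a a' ⟨hb, ha, fun c hc => h2.1 (hD ?_)⟩ hL hR
    simp only [Finset.mem_product] at hc ⊢
    exact hc.symm
  · refine h b b' a a' hD.2.1 hD.1 (fun c hc => h2.2 (hD.2.2 ?_)) hL hR
    simp only [Finset.mem_product] at hc ⊢
    exact hc.symm

theorem bijOn_flow_topClosed :
    Set.BijOn P.flow P.topClosed {σ | BruhatLE σ P.gridPerm} := by
  rw [topClosed_eq]
  exact P.peel_cellList.bijOn_listFlow (isHeight_upCount _) fun _ => P.lt_of_mem_cellList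

theorem card_add_invCount_of_mem_topClosed {S : Finset (ℕ × ℕ)} (hS : S ∈ P.topClosed) :
    S.card + invCount (P.flow S) = invCount P.gridPerm := by
  rw [topClosed_eq] at hS
  exact P.peel_cellList.card_add_invCount (isHeight_upCount _) (fun _ => P.lt_of_mem_cellList)
    hS.1 hS.2

theorem listFlow_reflect_cellList (S : Finset (ℕ × ℕ)) :
    listFlow m (S.image Prod.swap) (reflectList P.cellList) = (P.flow S)⁻¹ :=
  listFlow_reflectList m S P.cellList

theorem listFlow_reflect_cellList_empty :
    listFlow m ∅ (reflectList P.cellList) = P.gridPerm⁻¹ := by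
  simpa [gridPerm] using P.listFlow_reflect_cellList ∅

theorem bijOn_flow_bottomClosed :
    Set.BijOn P.flow P.bottomClosed {σ | BruhatLE σ P.gridPerm} := by
  have h1 := P.peel_cellList.reflect.bijOn_listFlow (isHeight_upCount _).reflect
    fun _ => P.lt_of_mem_reflectList
  rw [listFlow_reflect_cellList_empty] at h1
  refine ⟨fun S hS => ?_, fun S hS T hT h => ?_, fun σ hσ => ?_⟩
  · have := h1.mapsTo (P.mem_bottomClosed_iff.1 hS)
    simp only [listFlow_reflect_cellList] at this
    exact bruhatLE_inv_iff.1 this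
  · refine Finset.image_injective Prod.swap_injective
      (h1.injOn (P.mem_bottomClosed_iff.1 hS) (P.mem_bottomClosed_iff.1 hT) ?_)
    simp only [listFlow_reflect_cellList, h]
  · obtain ⟨S, hS, h2⟩ := h1.surjOn (BruhatLE.inv hσ)
    have h3 : (S.image Prod.swap).image Prod.swap = S := by
      simp [Finset.image_image]
    refine ⟨S.image Prod.swap, P.mem_bottomClosed_iff.2 (by rwa [h3]), ?_⟩
    rw [← inv_inj, ← listFlow_reflect_cellList, h3]
    exact h2

theorem card_add_invCount_of_mem_bottomClosed {S : Finset (ℕ × ℕ)} (hS : S ∈ P.bottomClosed) :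
    S.card + invCount (P.flow S) = invCount P.gridPerm := by
  have h1 := P.mem_bottomClosed_iff.1 hS
  have := P.peel_cellList.reflect.card_add_invCount (isHeight_upCount _).reflect
    (fun _ => P.lt_of_mem_reflectList) h1.1 h1.2
  rwa [listFlow_reflect_cellList_empty, listFlow_reflect_cellList, invCount_inv, invCount_inv,
    Finset.card_image_of_injective _ Prod.swap_injective] at this

end StaircasePolyomino

theorem mainTheorem1 {m : ℕ} (P : StaircasePolyomino m) :
    Set.BijOn P.flow P.bottomClosed {σ | BruhatLE σ P.gridPerm} ∧
    Set.BijOn P.flow P.topClosed {σ | BruhatLE σ P.gridPerm} ∧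
    (∀ S ∈ P.bottomClosed, S.card + invCount (P.flow S) = invCount P.gridPerm) ∧
    (∀ S ∈ P.topClosed, S.card + invCount (P.flow S) = invCount P.gridPerm) ∧
    ∃ e : P.bottomClosed ≃ P.topClosed, ∀ S : P.bottomClosed,
      P.flow (e S).1 = P.flow S.1 ∧ (e S).1.card = S.1.card := by
  have hB := P.bijOn_flow_bottomClosed
  have hT := P.bijOn_flow_topClosed
  refine ⟨hB, hT, fun S => P.card_add_invCount_of_mem_bottomClosed,
    fun S => P.card_add_invCount_of_mem_topClosed, (hB.equiv _).trans (hT.equiv _).symm,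
    fun S => ?_⟩
  have h1 : P.flow (((hB.equiv _).trans (hT.equiv _).symm) S).1 = P.flow S.1 :=
    congrArg Subtype.val ((hT.equiv _).apply_symm_apply (hB.equiv _ S))
  refine ⟨h1, ?_⟩
  have h2 := P.card_add_invCount_of_mem_bottomClosed S.2
  have h3 := P.card_add_invCount_of_mem_topClosed
    (((hB.equiv _).trans (hT.equiv _).symm) S).2
  rw [h1] at h3
  omega
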